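/- Let $F$ be a finite set of flights, $T=\{1,\dots,\bar T\}$ the set of time periods, $r_f\in\mathbb N$ the scheduled arrival time of $f\in F$, $T_f=\{r_f,\dots,\bar T\}$, $\mathcal C\subseteq F\times F$ the set of connecting pairs, $S_{f_1,f_2}\in\mathbb R$ the admissible delays, $C_f\in\mathbb R$ the unit ground holding costs and $C_h\ge 0$ the unit airborne holding cost. Let $\Xi\subseteq\mathbb R^m$ be a closed set (the support), and let the airport capacity $K:\Xi\to[0,\infty)$ be lower semicontinuous (for example continuous, or $\Xi\subseteq[0,\infty)$ and $K(\xi)=\xi$). Let $\widehat\xi_1,\dots,\widehat\xi_N\in\Xi$ be observations with probabilities $\widehat p_s\ge 0$, $\sum_{s=1}^N\widehat p_s=1$, and let $\epsilon>0$. For $A\subseteq\Xi$ let $v(A)\in[-\infty,+\infty]$ be the optimal value (with $v(A)=+\infty$ if there is no feasible point) of the program $$\min_{x,y,\alpha,\beta}\ \sum_{f\in F}C_f\Big(\sum_{t\in T_f}t\,x_{ft}-r_f\Big)+\epsilon\alpha+\sum_{s=1}^N\widehat p_s\beta_s$$ over $x_{ft}\in\{0,1\}$ ($f\in F$, $t\in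 T_f$; put $x_{ft}=0$ for $t\notin T_f$), $\alpha\ge 0$, $\beta\in\mathbb R^N$ and real $y_t(\xi)$ ($\xi\in A$, $0\le t\le\bar T$), subject to $$\begin{aligned} &\alpha\|\widehat\xi_s-\xi\|_2+\beta_s\ \ge\ \sum_{t\in T}C_h\,y_t(\xi), && \xi\in A,\ s=1,\dots,N,\\ &\sum_{t\in T_f}x_{ft}=1, && f\in F,\\ &\sum_{f\in F}x_{ft}\ \le\ K(\xi)-y_{t-1}(\xi)+y_t(\xi), && t\in T,\ \xi\in A,\\ &\sum_{t\in T_{f_1}}t\,x_{f_1t}-r_{f_1}-S_{f_1,f_2}\ \le\ \sum_{t\in T_{f_2}}t\,x_{f_2t}-r_{f_2}, && (f_1,f_2)\in\mathcal C,\\ &y_0(\xi)=0,\quad y_t(\xi)\ge 0, && t\in T,\ \xi\in A. \end{aligned}$$ Then the program with support $\Xi$ is finitely reducible, that is, there is a finite set $\Xi'\subseteq\Xi$ with $v(\Xi')=v(\Xi)$, and it is weakly discretizable, that is, there is a sequence of finite sets $\Xi_k\subseteq\Xi$ with $\lim_{k\to\infty}v(\Xi_k)=v(\Xi)$. -/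

import Mathlib

/-- Data of a distributionally robust single-airport ground holding problem with flights `F`,
`N` capacity observations and uncertain parameter `ξ` in `ℝ^m`. -/
structure GroundHolding (F : Type*) (N m : ℕ) where
  /-- planning horizon; the set of time periods is `{1, …, horizon}` -/
  horizon : ℕ
  /-- scheduled arrival times `r_f` -/
  r : F → ℕ
  /-- connecting pairs (preceding flight, successive flight) -/
  conn : Set (F × F)
  /-- maximum delay of `f₁` that causes no delay of `f₂` -/
  slack : F → F → ℝ
  /-- unit ground holding costs `C_f` -/
  groundCost : F → ℝ
  /-- unit airborne holding cost `C_h` -/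
  airCost : ℝ
  /-- realized airport capacity `K(ξ)` -/
  cap : EuclideanSpace ℝ (Fin m) → ℝ
  /-- observations `ξ̂_s` -/
  obs : Fin N → EuclideanSpace ℝ (Fin m)
  /-- estimated probabilities `p̂_s` -/
  prob : Fin N → ℝ
  /-- radius of the Wasserstein ball -/
  radius : ℝ

/-- Decision variables `(x, y, α, β)`. -/
structure GroundHolding.Decision (F : Type*) (N m : ℕ) where
  x : F → ℕ → ℝ
  y : EuclideanSpace ℝ (Fin m) → ℕ → ℝ
  α : ℝ
  β : Fin N → ℝ

namespace GroundHolding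

variable {F : Type*} {N m : ℕ}

/-- The set of time periods `T`. -/
def periods (D : GroundHolding F N m) : Finset ℕ := Finset.Icc 1 D.horizon

/-- The available arrival times `T_f = {r_f, …, T}`. -/
def slots (D : GroundHolding F N m) (f : F) : Finset ℕ := Finset.Icc (D.r f) D.horizon

/-- The ground delay `∑_{t ∈ T_f} t x_{ft} - r_f`. -/
def delay (D : GroundHolding F N m) (x : F → ℕ → ℝ) (f : F) : ℝ :=
  (∑ t ∈ D.slots f, (t : ℝ) * x f t) - (D.r f : ℝ)

/-- Objective of the deterministic equivalent program. -/
def objective [Fintype F] (D : GroundHolding F N m) (z : Decision F N m) : ℝ :=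
  (∑ f, D.groundCost f * D.delay z.x f) + D.radius * z.α + ∑ s, D.prob s * z.β s

/-- Feasibility for the deterministic equivalent program with support `S`. The variables `x_{ft}`
exist only for `t ∈ T_f`; this is expressed by `x_{ft} = 0` for the other `t`.
Only the values `y(ξ)` with `ξ ∈ S` are constrained, and only they matter. -/
structure Feasible [Fintype F] (D : GroundHolding F N m)
    (S : Set (EuclideanSpace ℝ (Fin m))) (z : Decision F N m) : Prop where
  robust : ∀ ξ ∈ S, ∀ s,
    ∑ t ∈ D.periods, D.airCost * z.y ξ t ≤ z.α * ‖D.obs s - ξ‖ + z.β s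
  assign : ∀ f, ∑ t ∈ D.slots f, z.x f t = 1
  capacity : ∀ t ∈ D.periods, ∀ ξ ∈ S,
    ∑ f, z.x f t ≤ D.cap ξ - z.y ξ (t - 1) + z.y ξ t
  coupling : ∀ f₁ f₂, (f₁, f₂) ∈ D.conn →
    D.delay z.x f₁ - D.slack f₁ f₂ ≤ D.delay z.x f₂
  binary : ∀ f, ∀ t ∈ D.slots f, z.x f t = 0 ∨ z.x f t = 1
  unavailable : ∀ f, ∀ t ∉ D.slots f, z.x f t = 0
  air_zero : ∀ ξ ∈ S, z.y ξ 0 = 0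
  air_nonneg : ∀ ξ ∈ S, ∀ t ∈ D.periods, 0 ≤ z.y ξ t
  dual_nonneg : 0 ≤ z.α

/-- The optimal value `v(S)` of the deterministic equivalent program with support `S`,
as an extended real (`⊤` if infeasible, `⊥` if unbounded below). -/
noncomputable def value [Fintype F] (D : GroundHolding F N m)
    (S : Set (EuclideanSpace ℝ (Fin m))) : EReal :=
  ⨅ z : {z : Decision F N m // D.Feasible S z}, ((D.objective z.1 : ℝ) : EReal)

end GroundHolding

/-- A semi-infinite program with index set `Ξ`, whose version with index set `S` has the optimal
value `v S`, is finitely reducible. -/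
def FinitelyReducible {E : Type*} (v : Set E → EReal) (Ξ : Set E) : Prop :=
  ∃ A : Finset E, (A : Set E) ⊆ Ξ ∧ v A = v Ξ

/-- A semi-infinite program with index set `Ξ`, whose version with index set `S` has the optimal
value `v S`, is weakly discretizable. -/
def WeaklyDiscretizable {E : Type*} (v : Set E → EReal) (Ξ : Set E) : Prop :=
  ∃ A : ℕ → Finset E, (∀ k, (A k : Set E) ⊆ Ξ) ∧
    Filter.Tendsto (fun k => v (A k)) Filter.atTop (nhds (v Ξ))

open Filter Topology

/-! For a fixed schedule the cheapest `y` is the recursion `airQueue`, so what remains in `α, β` is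
the dual of a worst-case expectation of the loss `ξ ↦ airLoss x (cap ξ)`. Eliminating `β` leaves a
minimization over `a ≥ 0` of a supremum of affine functions `G u + a * (ε - D u)`, where `u` picks
one support point per observation, `G` is the mean loss and `D` the mean transport distance.

In one variable two pieces suffice (`exists_pair_le_of_forall_approx`): a nondecreasing one to the
right of a threshold, a nonincreasing one to its left. Their points form a finite support for this
schedule. There are finitely many schedules, so the union of these supports serves all of them, and
a constant sequence gives weak discretizability. -/

/-! ### Finite reduction of a scalar convex minimization problem -/

/-- Upper semicontinuity and compactness: approximate solutions of `h ≤ G u + a * (ε - D u)` along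
a convergent sequence of parameters `a` accumulate at an exact solution for the limit parameter. -/
theorem exists_le_of_tendsto_of_isCompact {X : Type*} [PseudoMetricSpace X] {K : Set X}
    (hK : IsCompact K) {G D : X → ℝ} (hG : UpperSemicontinuousOn G K) (hD : Continuous D)
    {ε h a : ℝ} {u : ℕ → X} {b δ : ℕ → ℝ} (hu : ∀ n, u n ∈ K)
    (hb : Tendsto b atTop (𝓝 a)) (hδ : Tendsto δ atTop (𝓝 0))
    (hL : ∀ n, h - δ n ≤ G (u n) + b n * (ε - D (u n))) :
    ∃ w ∈ K, h ≤ G w + a * (ε - D w) := by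
  obtain ⟨w, hw, φ, hφ, hlim⟩ := hK.tendsto_subseq hu
  refine ⟨w, hw, ?_⟩
  by_contra! hlt
  obtain ⟨c, hc₁, hc₂⟩ := exists_between (show G w < h - a * (ε - D w) by linarith)
  have hwK : Tendsto (u ∘ φ) atTop (𝓝[K] w) :=
    tendsto_nhdsWithin_iff.2 ⟨hlim, Eventually.of_forall fun n => hu _⟩
  have h₁ : ∀ᶠ n in atTop, G (u (φ n)) < c := hwK.eventually (hG w hw c hc₁)
  have h₂ : Tendsto (fun n => h - δ (φ n) - b (φ n) * (ε - D (u (φ n)))) atTop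
      (𝓝 (h - 0 - a * (ε - D w))) :=
    ((tendsto_const_nhds.sub (hδ.comp hφ.tendsto_atTop))).sub
      ((hb.comp hφ.tendsto_atTop).mul
        (tendsto_const_nhds.sub ((hD.tendsto w).comp hlim)))
  have h₃ := h₂.eventually (lt_mem_nhds (show c < h - 0 - a * (ε - D w) by linarith))
  obtain ⟨n, hn₁, hn₂⟩ := (h₁.and h₃).exists
  have := hL (φ n)
  linarith

/-- If the upper envelope over `Ω` of the affine functions `a ↦ G u + a * (ε - D u)` is at least
`h` on `[0, ∞)`, then so is the envelope of two of them. -/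
theorem exists_pair_le_of_forall_approx {X : Type*} [PseudoMetricSpace X] {Ω : Set X}
    {G D : X → ℝ} (hG : UpperSemicontinuousOn G Ω) (hD : Continuous D)
    (hcpt : ∀ c, IsCompact (Ω ∩ {u | D u ≤ c})) {M ε h : ℝ} (hM : ∀ u ∈ Ω, G u ≤ M)
    (hε : 0 < ε) {u₀ : X} (hu₀ : u₀ ∈ Ω) (hDu₀ : D u₀ = 0)
    (happ : ∀ a, 0 ≤ a → ∀ δ > 0, ∃ u ∈ Ω, h - δ ≤ G u + a * (ε - D u)) :
    ∃ u ∈ Ω, ∃ w ∈ Ω, ∀ a, 0 ≤ a →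
      h ≤ G u + a * (ε - D u) ∨ h ≤ G w + a * (ε - D w) := by
  have hδ : Tendsto (fun n : ℕ => 1 / ((n : ℝ) + 1)) atTop (𝓝 0) :=
    tendsto_one_div_add_atTop_nhds_zero_nat
  have hδ_pos : ∀ n : ℕ, 0 < 1 / ((n : ℝ) + 1) := fun n => Nat.one_div_pos_of_nat
  have hδ_le : ∀ n : ℕ, 1 / ((n : ℝ) + 1) ≤ 1 := fun n => by
    rw [div_le_one (by positivity)]
    linarith [(Nat.cast_nonneg n : (0 : ℝ) ≤ n)]
  -- for a positive parameter the envelope is attained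
  have hattain : ∀ a, 0 < a → ∃ u ∈ Ω, h ≤ G u + a * (ε - D u) := by
    intro a ha
    choose u hu hLu using fun n : ℕ => happ a ha.le _ (hδ_pos n)
    -- Since `a > 0` and `G ≤ M`, near-maximizers have bounded `D`; the `+ 1` absorbs `δ ≤ 1`.
    have hmem : ∀ n, u n ∈ Ω ∩ {v | D v ≤ ε + (M - h + 1) / a} := by
      refine fun n => ⟨hu n, ?_⟩
      have h₁ : (D (u n) - ε) * a ≤ M - h + 1 := by
        linarith [hLu n, hM _ (hu n), hδ_le n]
      have := (le_div_iff₀ ha).2 h₁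
      simp only [Set.mem_ofPred_eq]
      linarith
    obtain ⟨w, hw, hLw⟩ := exists_le_of_tendsto_of_isCompact (hcpt _)
      (hG.mono Set.inter_subset_left) hD hmem tendsto_const_nhds hδ hLu
    exact ⟨w, hw.1, hLw⟩
  -- Parameters at which a piece of slope `ε - D u ≥ 0` reaches `h`. The least one yields the
  -- right-hand piece.
  let P : Set ℝ := {a | 0 ≤ a ∧ ∃ u ∈ Ω, D u ≤ ε ∧ h ≤ G u + a * (ε - D u)}
  have hP_bdd : BddBelow P := ⟨0, fun a ha => ha.1⟩
  have hP_ne : P.Nonempty := by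
    refine ⟨max 0 ((h - G u₀) / ε), le_max_left _ _, u₀, hu₀, by linarith, ?_⟩
    have h₁ := (div_le_iff₀ hε).1 (le_max_right 0 ((h - G u₀) / ε))
    rw [hDu₀, sub_zero]
    linarith
  have hP_closed : IsClosed P := by
    refine IsSeqClosed.isClosed fun b a hb hba => ?_
    choose hb₀ u hu hDu hLu using hb
    obtain ⟨w, hw, hLw⟩ := exists_le_of_tendsto_of_isCompact (hcpt ε)
      (hG.mono Set.inter_subset_left) hD (fun n => ⟨hu n, hDu n⟩) hba
      (tendsto_const_nhds (x := (0 : ℝ))) (fun n => by simpa using hLu n)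
    exact ⟨ge_of_tendsto' hba hb₀, w, hw.1, hw.2, hLw⟩
  obtain ⟨ha₀, u, hu, hDu, hLu⟩ := hP_closed.csInf_mem hP_ne hP_bdd
  have hright : ∀ a, sInf P ≤ a → h ≤ G u + a * (ε - D u) := by
    intro a ha
    nlinarith [mul_nonneg (sub_nonneg.2 ha) (sub_nonneg.2 hDu)]
  rcases ha₀.eq_or_lt with h0 | hpos
  · exact ⟨u, hu, u, hu, fun a ha => Or.inl (hright a (h0 ▸ ha))⟩
  set a₀ := sInf P with ha₀_def
  -- Approach `a₀` from below. These parameters lie outside `P`, so pieces reaching `h` there have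
  -- slope at most `0`; staying above `a₀ / 2` bounds `D` along them. A limit point is the left-hand
  -- piece.
  have hb : Tendsto (fun n : ℕ => a₀ - a₀ / 2 * (1 / ((n : ℝ) + 1))) atTop (𝓝 a₀) := by
    simpa using tendsto_const_nhds.sub (hδ.const_mul (a₀ / 2))
  have hb_half : ∀ n : ℕ, a₀ / 2 ≤ a₀ - a₀ / 2 * (1 / ((n : ℝ) + 1)) := fun n => by
    nlinarith [hδ_le n]
  have hb_lt : ∀ n : ℕ, a₀ - a₀ / 2 * (1 / ((n : ℝ) + 1)) < a₀ := fun n => by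
    nlinarith [mul_pos hpos (hδ_pos n)]
  choose v hv hLv using fun n : ℕ => hattain (a₀ - a₀ / 2 * (1 / ((n : ℝ) + 1)))
    (by linarith [hb_half n])
  have hDv : ∀ n, ε ≤ D (v n) := by
    intro n
    by_contra! hlt
    have : a₀ ≤ _ := csInf_le hP_bdd
      (show a₀ - a₀ / 2 * (1 / ((n : ℝ) + 1)) ∈ P from
        ⟨by linarith [hb_half n], v n, hv n, hlt.le, hLv n⟩)
    linarith [hb_lt n]
  have hmem : ∀ n, v n ∈ (Ω ∩ {v | D v ≤ ε + (M - h) / (a₀ / 2)}) ∩ {v | ε ≤ D v} := by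
    refine fun n => ⟨⟨hv n, ?_⟩, hDv n⟩
    have h₁ : (D (v n) - ε) * (a₀ / 2) ≤ M - h := by
      nlinarith [hLv n, hM _ (hv n), mul_nonneg (sub_nonneg.2 (hDv n))
        (sub_nonneg.2 (hb_half n))]
    have := (le_div_iff₀ (half_pos hpos)).2 h₁
    simp only [Set.mem_ofPred_eq]
    linarith
  obtain ⟨w, ⟨⟨hw, -⟩, hDw⟩, hLw⟩ := exists_le_of_tendsto_of_isCompact
    ((hcpt _).inter_right (isClosed_le continuous_const hD))
    (hG.mono (Set.inter_subset_left.trans Set.inter_subset_left)) hD hmem hb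
    (tendsto_const_nhds (x := (0 : ℝ))) (fun n => by simpa using hLv n)
  refine ⟨u, hu, w, hw, fun a ha => ?_⟩
  rcases le_total a₀ a with hle | hle
  · exact Or.inl (hright a hle)
  · have hDw' : ε ≤ D w := hDw
    exact Or.inr (by nlinarith [mul_nonneg (sub_nonneg.2 hle) (sub_nonneg.2 hDw')])

/-! ### The dual of a worst-case expectation over a Wasserstein ball -/

/-- Constraints of the dual of a worst-case expectation of the loss `g` over a Wasserstein ball
with centers `o`, restricted to the support `S`. -/
def IsDualFeasible {ι E : Type*} [NormedAddCommGroup E] (o : ι → E) (g : E → ℝ) (S : Set E)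
    (α : ℝ) (β : ι → ℝ) : Prop :=
  0 ≤ α ∧ ∀ ξ ∈ S, ∀ s, g ξ ≤ α * ‖o s - ξ‖ + β s

/-- The weighted sum does not control coordinates of weight zero, so these are pinned to the
centers; every other coordinate stays in a ball. -/
theorem isCompact_setOf_weighted_dist_le {ι E : Type*} [Fintype ι] [NormedAddCommGroup E]
    [ProperSpace E] {Ξ : Set E} (hΞ : IsClosed Ξ) (o : ι → E) {p : ι → ℝ} (hp : ∀ s, 0 ≤ p s)
    (c : ℝ) :
    IsCompact ({u : ι → E | ∀ s, u s ∈ Ξ ∧ (p s = 0 → u s = o s)} ∩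
      {u | ∑ s, p s * ‖o s - u s‖ ≤ c}) := by
  have hclosed : IsClosed {u : ι → E | ∀ s, u s ∈ Ξ ∧ (p s = 0 → u s = o s)} := by
    simp only [Set.ofPred_forall, Set.ofPred_and]
    refine isClosed_iInter fun s => (hΞ.preimage (continuous_apply s)).inter ?_
    exact isClosed_iInter fun _ => isClosed_eq (continuous_apply s) continuous_const
  refine IsCompact.of_isClosed_subset
    -- For `p s = 0` the radius is `0` by the convention for division by zero, which fits the pinned
    -- coordinate.
    (isCompact_univ_pi fun s => isCompact_closedBall (o s) (|c| / p s))
    (hclosed.inter (isClosed_le (by fun_prop) continuous_const)) ?_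
  rintro u ⟨hu, hc⟩ s -
  rw [Metric.mem_closedBall, dist_comm, dist_eq_norm]
  rcases (hp s).eq_or_lt with h0 | hpos
  · rw [(hu s).2 h0.symm, sub_self, norm_zero]
    exact div_nonneg (abs_nonneg _) (hp s)
  · rw [le_div_iff₀ hpos, mul_comm]
    calc p s * ‖o s - u s‖ ≤ ∑ s, p s * ‖o s - u s‖ :=
          Finset.single_le_sum (f := fun s => p s * ‖o s - u s‖)
            (fun s _ => mul_nonneg (hp s) (norm_nonneg _)) (Finset.mem_univ s)
      _ ≤ c := hc
      _ ≤ |c| := le_abs_self c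

/-- The dual of a worst-case expectation of a bounded upper semicontinuous loss over a Wasserstein
ball has a finite reduction: for a suitable finite `A ⊆ Ξ`, the dual values for the support `A` are
not below the infimum of those for the support `Ξ`. -/
theorem exists_finset_isDualFeasible_reduction {ι E : Type*} [Fintype ι] [NormedAddCommGroup E]
    [ProperSpace E] {Ξ : Set E} (hΞ : IsClosed Ξ) {o : ι → E} (ho : ∀ s, o s ∈ Ξ)
    {p : ι → ℝ} (hp : ∀ s, 0 ≤ p s) (hp_sum : ∑ s, p s = 1) {ε : ℝ} (hε : 0 < ε)
    {g : E → ℝ} (hg : UpperSemicontinuousOn g Ξ) (hg_nonneg : ∀ ξ ∈ Ξ, 0 ≤ g ξ) {M : ℝ}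
    (hg_le : ∀ ξ ∈ Ξ, g ξ ≤ M) :
    ∃ A : Finset E, (A : Set E) ⊆ Ξ ∧ ∀ α β, IsDualFeasible o g A α β →
      ∀ w, ε * α + ∑ s, p s * β s < w →
        ∃ α' β', IsDualFeasible o g Ξ α' β' ∧ ε * α' + ∑ s, p s * β' s < w := by
  classical
  let V : Set ℝ := {v | ∃ α β, IsDualFeasible o g Ξ α β ∧ v = ε * α + ∑ s, p s * β s}
  have hV_ne : V.Nonempty :=
    ⟨_, 0, fun _ => M, ⟨le_rfl, fun ξ hξ s => by simpa using hg_le ξ hξ⟩, rfl⟩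
  have hV_bdd : BddBelow V := by
    refine ⟨0, ?_⟩
    rintro _ ⟨α, β, ⟨hα, hβ⟩, rfl⟩
    have hβ₀ : ∀ s, 0 ≤ β s := fun s => by
      have := hβ _ (ho s) s
      rw [sub_self, norm_zero, mul_zero, zero_add] at this
      exact (hg_nonneg _ (ho s)).trans this
    exact add_nonneg (mul_nonneg hε.le hα)
      (Finset.sum_nonneg fun s _ => mul_nonneg (hp s) (hβ₀ s))
  let Ω : Set (ι → E) := {u | ∀ s, u s ∈ Ξ ∧ (p s = 0 → u s = o s)}
  let G : (ι → E) → ℝ := fun u => ∑ s, p s * g (u s)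
  let D : (ι → E) → ℝ := fun u => ∑ s, p s * ‖o s - u s‖
  have hG : UpperSemicontinuousOn G Ω := by
    refine upperSemicontinuousOn_sum fun s _ => ?_
    have h₁ : UpperSemicontinuousOn (fun u : ι → E => g (u s)) Ω :=
      hg.comp (continuous_apply s).continuousOn fun u hu => (hu s).1
    exact Continuous.comp_upperSemicontinuousOn (g := fun y : ℝ => p s * y) (by fun_prop) h₁
      fun y z hyz => mul_le_mul_of_nonneg_left hyz (hp s)
  have hG_le : ∀ u ∈ Ω, G u ≤ M := fun u hu =>
    calc G u ≤ ∑ s, p s * M :=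
          Finset.sum_le_sum fun s _ => mul_le_mul_of_nonneg_left (hg_le _ (hu s).1) (hp s)
      _ = M := by rw [← Finset.sum_mul, hp_sum, one_mul]
  have hGD : ∀ u a, G u + a * (ε - D u) = ε * a + ∑ s, p s * (g (u s) - a * ‖o s - u s‖) := by
    intro u a
    simp only [G, D, mul_sub, Finset.sum_sub_distrib, Finset.mul_sum]
    have : ∀ s, p s * (a * ‖o s - u s‖) = a * (p s * ‖o s - u s‖) := fun s => by ring
    simp only [this]
    ring
  have happ : ∀ a, 0 ≤ a → ∀ δ > 0, ∃ u ∈ Ω, sInf V - δ ≤ G u + a * (ε - D u) := by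
    intro a ha δ hδ
    -- The least feasible `β s` for the given `a` is `sSup (B s)`; near-maximizers lose at most `δ`
    -- on average because the weights sum to `1`.
    let B : ι → Set ℝ := fun s => (fun ξ => g ξ - a * ‖o s - ξ‖) '' Ξ
    have hB_bdd : ∀ s, BddAbove (B s) := by
      refine fun s => ⟨M, ?_⟩
      rintro _ ⟨ξ, hξ, rfl⟩
      have := mul_nonneg ha (norm_nonneg (o s - ξ))
      have := hg_le ξ hξ
      simp only
      linarith
    have hex : ∀ s, ∃ ξ, (ξ ∈ Ξ ∧ (p s = 0 → ξ = o s)) ∧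
        p s * (sSup (B s) - δ) ≤ p s * (g ξ - a * ‖o s - ξ‖) := by
      intro s
      by_cases hs : p s = 0
      · exact ⟨o s, ⟨ho s, fun _ => rfl⟩, by simp [hs]⟩
      · obtain ⟨_, ⟨ξ, hξ, rfl⟩, hlt⟩ := exists_lt_of_lt_csSup
          (show (B s).Nonempty from ⟨_, o s, ho s, rfl⟩)
          (show sSup (B s) - δ < sSup (B s) by linarith)
        exact ⟨ξ, ⟨hξ, fun h => absurd h hs⟩, mul_le_mul_of_nonneg_left hlt.le (hp s)⟩
    choose u hu hle using hex
    refine ⟨u, hu, ?_⟩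
    have hfeas : IsDualFeasible o g Ξ a fun s => sSup (B s) := by
      refine ⟨ha, fun ξ hξ s => ?_⟩
      have := le_csSup (hB_bdd s) ⟨ξ, hξ, rfl⟩
      simp only at this
      linarith
    have h₁ : sInf V ≤ ε * a + ∑ s, p s * sSup (B s) := csInf_le hV_bdd ⟨a, _, hfeas, rfl⟩
    have h₂ := Finset.sum_le_sum fun s (_ : s ∈ Finset.univ) => hle s
    simp only [mul_sub (p _) (sSup _), Finset.sum_sub_distrib, ← Finset.sum_mul, hp_sum] at h₂
    rw [hGD]
    linarith
  obtain ⟨u, hu, w, hw, huw⟩ := exists_pair_le_of_forall_approx hG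
    (show Continuous D by fun_prop) (isCompact_setOf_weighted_dist_le hΞ o hp) hG_le hε
    (show o ∈ Ω from fun s => ⟨ho s, fun _ => rfl⟩) (by simp [D]) happ
  refine ⟨Finset.univ.image u ∪ Finset.univ.image w, ?_, ?_⟩
  · intro ξ hξ
    simp only [Finset.coe_union, Finset.coe_image, Finset.coe_univ, Set.image_univ,
      Set.mem_union, Set.mem_range] at hξ
    rcases hξ with ⟨s, rfl⟩ | ⟨s, rfl⟩
    exacts [(hu s).1, (hw s).1]
  · rintro α β ⟨hα, hβ⟩ c hc
    -- Averaging the constraints at `v s` with weights `p s` bounds the dual value below by the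
    -- affine piece of `v`.
    have hlow : ∀ v : ι → E, (∀ s, g (v s) ≤ α * ‖o s - v s‖ + β s) →
        G v + α * (ε - D v) ≤ ε * α + ∑ s, p s * β s := by
      intro v hv
      rw [hGD]
      have := Finset.sum_le_sum fun s (_ : s ∈ Finset.univ) =>
        mul_le_mul_of_nonneg_left (sub_le_iff_le_add'.2 (hv s)) (hp s)
      linarith
    have hu' := hlow u fun s => hβ _ (by simp) s
    have hw' := hlow w fun s => hβ _ (by simp) s
    have hV : sInf V < c := by
      rcases huw α hα with h | h <;> linarith
    obtain ⟨_, ⟨α', β', hfeas, rfl⟩, hlt⟩ := exists_lt_of_csInf_lt hV_ne hV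
    exact ⟨α', β', hfeas, hlt⟩

/-! ### Minimal airborne queues -/

/-- The least airborne queue for arrival counts `n` and capacity `κ`. -/
noncomputable def airQueue (n : ℕ → ℝ) (κ : ℝ) : ℕ → ℝ
  | 0 => 0
  | t + 1 => max 0 (n (t + 1) - κ + airQueue n κ t)

theorem airQueue_nonneg (n : ℕ → ℝ) (κ : ℝ) (t : ℕ) : 0 ≤ airQueue n κ t := by
  cases t with
  | zero => exact le_rfl
  | succ t => exact le_max_left _ _

theorem airQueue_antitone (n : ℕ → ℝ) (t : ℕ) : Antitone fun κ => airQueue n κ t := by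
  induction t with
  | zero => exact fun _ _ _ => le_rfl
  | succ t ih =>
    intro κ κ' h
    have := ih h
    exact max_le_max le_rfl (by simp only at this; linarith)

theorem continuous_airQueue (n : ℕ → ℝ) (t : ℕ) : Continuous fun κ => airQueue n κ t := by
  induction t with
  | zero => exact continuous_const
  | succ t ih =>
    exact continuous_const.max ((continuous_const.sub continuous_id).add ih)

/-- Nonnegativity and the capacity constraint bound `y (t + 1)` below by the two arguments of the
`max`, the second by induction. -/
theorem airQueue_le {n y : ℕ → ℝ} {κ : ℝ} {T : ℕ} (h₀ : y 0 = 0)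
    (hy : ∀ t ∈ Finset.Icc 1 T, 0 ≤ y t)
    (hcap : ∀ t ∈ Finset.Icc 1 T, n t ≤ κ - y (t - 1) + y t) {t : ℕ} (ht : t ≤ T) :
    airQueue n κ t ≤ y t := by
  induction t with
  | zero => exact h₀.ge
  | succ t ih =>
    have hmem : t + 1 ∈ Finset.Icc 1 T := Finset.mem_Icc.2 ⟨by omega, ht⟩
    have h₁ := hcap _ hmem
    rw [Nat.add_sub_cancel] at h₁
    exact max_le (hy _ hmem) (by linarith [ih (by omega)])

/-! ### Eliminating the airborne queues and combining all schedules -/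

namespace GroundHolding

variable {F : Type*} [Fintype F] {N m : ℕ}

/-- The least airborne holding cost of the schedule `x` at capacity `κ`. -/
noncomputable def airLoss (D : GroundHolding F N m) (x : F → ℕ → ℝ) (κ : ℝ) : ℝ :=
  ∑ t ∈ D.periods, D.airCost * airQueue (fun t => ∑ f, x f t) κ t

theorem airLoss_nonneg (D : GroundHolding F N m) (hair : 0 ≤ D.airCost) (x : F → ℕ → ℝ) (κ : ℝ) :
    0 ≤ D.airLoss x κ :=
  Finset.sum_nonneg fun _ _ => mul_nonneg hair (airQueue_nonneg _ _ _)

theorem airLoss_antitone (D : GroundHolding F N m) (hair : 0 ≤ D.airCost) (x : F → ℕ → ℝ) :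
    Antitone (D.airLoss x) := fun _ _ h =>
  Finset.sum_le_sum fun _ _ => mul_le_mul_of_nonneg_left (airQueue_antitone _ _ h) hair

theorem continuous_airLoss (D : GroundHolding F N m) (x : F → ℕ → ℝ) :
    Continuous (D.airLoss x) :=
  continuous_finsetSum _ fun _ _ => continuous_const.mul (continuous_airQueue _ _)

theorem Feasible.isDualFeasible {D : GroundHolding F N m} {S : Set (EuclideanSpace ℝ (Fin m))}
    {z : Decision F N m} (hz : D.Feasible S z) (hair : 0 ≤ D.airCost) :
    IsDualFeasible D.obs (fun ξ => D.airLoss z.x (D.cap ξ)) S z.α z.β := by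
  refine ⟨hz.dual_nonneg, fun ξ hξ s => le_trans ?_ (hz.robust ξ hξ s)⟩
  refine Finset.sum_le_sum fun t ht => mul_le_mul_of_nonneg_left ?_ hair
  exact airQueue_le (hz.air_zero ξ hξ) (hz.air_nonneg ξ hξ)
    (fun t ht => hz.capacity t ht ξ hξ) (Finset.mem_Icc.1 ht).2

/-- The schedule of a feasible decision, the least airborne queues and any dual feasible pair form
a feasible decision. -/
theorem Feasible.of_isDualFeasible {D : GroundHolding F N m}
    {S S' : Set (EuclideanSpace ℝ (Fin m))} {z : Decision F N m} (hz : D.Feasible S z)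
    {α : ℝ} {β : Fin N → ℝ}
    (h : IsDualFeasible D.obs (fun ξ => D.airLoss z.x (D.cap ξ)) S' α β) :
    D.Feasible S' ⟨z.x, fun ξ => airQueue (fun t => ∑ f, z.x f t) (D.cap ξ), α, β⟩ where
  robust := h.2
  assign := hz.assign
  capacity := by
    intro t ht ξ _
    obtain ⟨k, rfl⟩ := Nat.exists_eq_add_of_le' (Finset.mem_Icc.1 ht).1
    have : (∑ f, z.x f (k + 1)) - D.cap ξ + airQueue (fun t => ∑ f, z.x f t) (D.cap ξ) k ≤
        airQueue (fun t => ∑ f, z.x f t) (D.cap ξ) (k + 1) := le_max_right _ _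
    simp only [Nat.add_sub_cancel]
    linarith
  coupling := hz.coupling
  binary := hz.binary
  unavailable := hz.unavailable
  air_zero := fun _ _ => rfl
  air_nonneg := fun _ _ _ _ => airQueue_nonneg _ _ _
  dual_nonneg := h.1

theorem Feasible.mono {D : GroundHolding F N m} {S S' : Set (EuclideanSpace ℝ (Fin m))}
    {z : Decision F N m} (hz : D.Feasible S z) (h : S' ⊆ S) : D.Feasible S' z where
  robust := fun ξ hξ => hz.robust ξ (h hξ)
  assign := hz.assign
  capacity := fun t ht ξ hξ => hz.capacity t ht ξ (h hξ)
  coupling := hz.coupling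
  binary := hz.binary
  unavailable := hz.unavailable
  air_zero := fun ξ hξ => hz.air_zero ξ (h hξ)
  air_nonneg := fun ξ hξ => hz.air_nonneg ξ (h hξ)
  dual_nonneg := hz.dual_nonneg

theorem value_mono (D : GroundHolding F N m) {S S' : Set (EuclideanSpace ℝ (Fin m))}
    (h : S' ⊆ S) : D.value S' ≤ D.value S :=
  le_iInf fun z => iInf_le_of_le ⟨z.1, z.2.mono h⟩ le_rfl

/-- A schedule is determined by the subset of slots it uses for each flight. -/
theorem finite_binary_schedules (D : GroundHolding F N m) :
    {x : F → ℕ → ℝ | (∀ f, ∀ t ∈ D.slots f, x f t = 0 ∨ x f t = 1) ∧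
      ∀ f, ∀ t ∉ D.slots f, x f t = 0}.Finite := by
  classical
  refine (Set.finite_range fun (c : (f : F) → Set (D.slots f)) (f : F) (t : ℕ) =>
    if ∃ h : t ∈ D.slots f, (⟨t, h⟩ : D.slots f) ∈ c f then (1 : ℝ) else 0).subset ?_
  rintro x ⟨hx₁, hx₀⟩
  refine ⟨fun f => {t | x f t = 1}, ?_⟩
  ext f t
  by_cases ht : t ∈ D.slots f
  · rcases hx₁ f t ht with h | h <;> simp [ht, h]
  · simp [ht, hx₀ f t ht]

theorem exists_finset_value_eq (D : GroundHolding F N m) {Ξ : Set (EuclideanSpace ℝ (Fin m))}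
    (hΞ : IsClosed Ξ) (hcap_nonneg : ∀ ξ ∈ Ξ, 0 ≤ D.cap ξ)
    (hcap_lsc : LowerSemicontinuousOn D.cap Ξ) (hair : 0 ≤ D.airCost) (hradius : 0 < D.radius)
    (hobs : ∀ s, D.obs s ∈ Ξ) (hprob_nonneg : ∀ s, 0 ≤ D.prob s)
    (hprob_sum : ∑ s, D.prob s = 1) :
    ∃ A : Finset (EuclideanSpace ℝ (Fin m)), (A : Set _) ⊆ Ξ ∧ D.value A = D.value Ξ := by
  classical
  have hred := fun x : F → ℕ → ℝ => exists_finset_isDualFeasible_reduction hΞ hobs hprob_nonneg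
    hprob_sum hradius (g := fun ξ => D.airLoss x (D.cap ξ))
    -- A continuous antitone function of a lower semicontinuous capacity is upper semicontinuous.
    -- The uniform bound on the loss is its value at capacity `0`.
    ((D.continuous_airLoss x).comp_lowerSemicontinuousOn_antitone hcap_lsc
      (D.airLoss_antitone hair x))
    (fun ξ _ => D.airLoss_nonneg hair x _)
    (fun ξ hξ => D.airLoss_antitone hair x (hcap_nonneg ξ hξ))
  choose A hA hAred using hred
  let B := D.finite_binary_schedules.toFinset.biUnion A
  have hB : (B : Set _) ⊆ Ξ := by
    intro ξ hξ
    obtain ⟨x, -, hx⟩ := Finset.mem_biUnion.1 (Finset.mem_coe.1 hξ)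
    exact hA x hx
  refine ⟨B, hB, le_antisymm (D.value_mono hB) (le_iInf ?_)⟩
  rintro ⟨z, hz⟩
  have hAB : A z.x ⊆ B := Finset.subset_biUnion_of_mem A
    (D.finite_binary_schedules.mem_toFinset.2 ⟨hz.binary, hz.unavailable⟩)
  -- Comparison with every real `w` above the objective avoids any need for the infimum over `Ξ` to
  -- be attained.
  refine EReal.le_of_forall_lt_iff_le.1 fun w hw => ?_
  have hw' : D.objective z < w := EReal.coe_lt_coe_iff.1 hw
  simp only [objective] at hw'
  obtain ⟨α, β, hfeas, hlt⟩ := hAred z.x z.α z.β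
    ((hz.mono (Finset.coe_subset.2 hAB)).isDualFeasible hair)
    (w - ∑ f, D.groundCost f * D.delay z.x f) (by linarith)
  refine iInf_le_of_le ⟨_, hz.of_isDualFeasible hfeas⟩ (EReal.coe_le_coe_iff.2 ?_)
  simp only [objective]
  linarith

end GroundHolding

theorem proposition3 {F : Type*} [Fintype F] {N m : ℕ} (D : GroundHolding F N m)
    (Ξ : Set (EuclideanSpace ℝ (Fin m)))
    (hΞ : IsClosed Ξ)
    (hcap_nonneg : ∀ ξ ∈ Ξ, 0 ≤ D.cap ξ)
    (hcap_lsc : LowerSemicontinuousOn D.cap Ξ)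
    (hair : 0 ≤ D.airCost)
    (hradius : 0 < D.radius)
    (hobs : ∀ s, D.obs s ∈ Ξ)
    (hprob_nonneg : ∀ s, 0 ≤ D.prob s)
    (hprob_sum : ∑ s, D.prob s = 1) :
    FinitelyReducible D.value Ξ ∧ WeaklyDiscretizable D.value Ξ := by
  obtain ⟨A, hA, hv⟩ := D.exists_finset_value_eq hΞ hcap_nonneg hcap_lsc hair hradius hobs
    hprob_nonneg hprob_sum
  exact ⟨⟨A, hA, hv⟩, fun _ => A, fun _ => hA, hv ▸ tendsto_const_nhds⟩
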